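/- A nondeterministic discounted-sum automaton (NDA) with discount factor $\lambda$, or $\lambda$-NDA, is a tuple $\mathcal A=\langle\Sigma,Q,\iota,\delta,\gamma\rangle$ with a finite alphabet $\Sigma$, a finite set of states $Q$, a nonempty set of initial states $\iota\subseteq Q$, a transition relation $\delta\subseteq Q\times\Sigma\times Q$ that is complete (for all $q\in Q$ and $\sigma\in\Sigma$ there is $q'$ with $(q,\sigma,q')\in\delta$), and a weight function $\gamma:\delta\to\mathbb Q$. A run $r$ of $\mathcal A$ on a finite or infinite word $w$ is a sequence of states $p_0,p_1,\dots$ with $p_0\in\iota$ and $(p_i,w(i),p_{i+1})\in\delta$ for all $0\le i<|w|$; its value is $\mathcal A(r)=\sum_{0\le i<|w|}\gamma(p_i,w(i),p_{i+1})\,\lambda^{-i}$, and $\mathcal A(w)=\inf\{\mathcal A(r) : r\text{ is a run of }\mathcal A\text{ on }w\}$. Theorem. There are a finite alphabet $\Sigma$ and a real constant $c>0$ such that for every integer $\lambda\ge 2$ and every integer $n\ge 1$ there is a $\lambda$-NDA $\mathcal A$ over $\Sigma$ with $n$ states such that the following holds. Let $\mathcal B$ be a $\lambda$-NDA over $\Sigma$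 with $\mathcal B(w)=-\mathcal A(w)$ for all finite words $w$, or with $\mathcal B(w)=-\mathcal A(w)$ for all infinite words $w$. Then $\mathcal B$ has at least $c\cdot 2^n$ states. -/

import Mathlib

/-- A nondeterministic discounted-sum automaton with multiple discount factors, over the alphabet
`α` and with states `Q` (both are taken finite where automata are used). It is complete and has at
least one initial state, so that every word has a run. Only the values of `weight` and
`discount` on members of `trans` are ever used. -/
structure NMDA (α Q : Type) where
  init : Set Q
  trans : Set (Q × α × Q)
  weight : Q × α × Q → ℚ
  discount : Q × α × Q → ℚ
  one_lt_discount : ∀ t ∈ trans, 1 < discount t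
  init_nonempty : init.Nonempty
  complete : ∀ q a, ∃ q', (q, a, q') ∈ trans

namespace NMDA

variable {α Q : Type}

/-- The automaton is a `l`-NDA: all its transitions have the discount factor `l`. -/
def IsNDA (A : NMDA α Q) (l : ℕ) : Prop :=
  ∀ t ∈ A.trans, A.discount t = l

/-! ### Finite words -/

/-- The `i`-th transition of the walk on the finite word `u` that visits the states `r`. -/
def finTrans (u : List α) (r : Fin (u.length + 1) → Q) (i : Fin u.length) : Q × α × Q :=
  (r i.castSucc, u.get i, r i.succ)

/-- `r` is the state sequence of a run of `A` on the finite word `u`. -/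
def IsFinRun (A : NMDA α Q) (u : List α) (r : Fin (u.length + 1) → Q) : Prop :=
  r 0 ∈ A.init ∧ ∀ i, finTrans u r i ∈ A.trans

/-- The value of a finite walk: the sum over `i` of the weight of its `i`-th transition divided by
the product of the discount factors of the earlier transitions. -/
noncomputable def finRunValue (A : NMDA α Q) (u : List α) (r : Fin (u.length + 1) → Q) : ℝ :=
  ∑ i, (A.weight (finTrans u r i) : ℝ) *
    ∏ j ∈ Finset.Iio i, 1 / (A.discount (finTrans u r j) : ℝ)

/-- The value of `A` on a finite word: the infimum of the values of its runs on it. -/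
noncomputable def finValue (A : NMDA α Q) (u : List α) : ℝ :=
  sInf {v | ∃ r, A.IsFinRun u r ∧ A.finRunValue u r = v}

/-! ### Infinite words -/

/-- The `i`-th transition of the walk on the infinite word `w` that visits the states `r`. -/
def infTrans (w : ℕ → α) (r : ℕ → Q) (i : ℕ) : Q × α × Q :=
  (r i, w i, r (i + 1))

/-- `r` is the state sequence of a run of `A` on the infinite word `w`. -/
def IsInfRun (A : NMDA α Q) (w : ℕ → α) (r : ℕ → Q) : Prop :=
  r 0 ∈ A.init ∧ ∀ i, infTrans w r i ∈ A.trans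

/-- The `i`-th summand of the value of an infinite walk. -/
noncomputable def infRunTerm (A : NMDA α Q) (w : ℕ → α) (r : ℕ → Q) (i : ℕ) : ℝ :=
  (A.weight (infTrans w r i) : ℝ) *
    ∏ j ∈ Finset.range i, 1 / (A.discount (infTrans w r j) : ℝ)

/-- The value of an infinite walk (the series converges, see `summable_infRunTerm`). -/
noncomputable def infRunValue (A : NMDA α Q) (w : ℕ → α) (r : ℕ → Q) : ℝ :=
  ∑' i, A.infRunTerm w r i

/-- The value of `A` on an infinite word: the infimum of the values of its runs on it. -/
noncomputable def infValue (A : NMDA α Q) (w : ℕ → α) : ℝ :=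
  sInf {v | ∃ r, A.IsInfRun w r ∧ A.infRunValue w r = v}

/-! ### Negation -/

/-- `B` is equivalent to `-A` with respect to finite words. -/
def EquivNegFin {Q' : Type} (B : NMDA α Q') (A : NMDA α Q) : Prop :=
  ∀ u : List α, B.finValue u = -A.finValue u

/-- `B` is equivalent to `-A` with respect to infinite words. -/
def EquivNegInf {Q' : Type} (B : NMDA α Q') (A : NMDA α Q) : Prop :=
  ∀ w : ℕ → α, B.infValue w = -A.infValue w

/-! ### The values are well defined: the infima are over nonempty sets that are bounded below, and
the series converge -/

theorem exists_isInfRun (A : NMDA α Q) (w : ℕ → α) : ∃ r, A.IsInfRun w r := by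
  obtain ⟨q, hq⟩ := A.init_nonempty
  choose f hf using A.complete
  exact ⟨fun n => Nat.rec q (fun k p => f p (w k)) n, hq, fun i => hf _ _⟩

theorem exists_isFinRun (A : NMDA α Q) (u : List α) : ∃ r, A.IsFinRun u r := by
  obtain ⟨q, hq⟩ := A.init_nonempty
  choose f hf using A.complete
  refine ⟨fun n => Fin.induction (motive := fun _ => Q) q (fun k p => f p (u.get k)) n, hq,
    fun i => ?_⟩
  simp only [finTrans, Fin.induction_succ]
  exact hf _ _

theorem bddBelow_finRunValue [Finite Q] (A : NMDA α Q) (u : List α) :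
    BddBelow {v | ∃ r, A.IsFinRun u r ∧ A.finRunValue u r = v} := by
  have h : (Set.range (A.finRunValue u)).Finite := Set.finite_range _
  exact h.bddBelow.mono (by rintro v ⟨r, -, rfl⟩; exact ⟨r, rfl⟩)

theorem exists_bound_infRunTerm [Finite α] [Finite Q] (A : NMDA α Q) :
    ∃ M b : ℝ, 0 ≤ b ∧ b < 1 ∧ ∀ w r, A.IsInfRun w r → ∀ i, ‖A.infRunTerm w r i‖ ≤ M * b ^ i := by
  classical
  obtain ⟨M, hM⟩ := (Set.finite_range (fun t => |(A.weight t : ℝ)|)).bddAbove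
  rcases isEmpty_or_nonempty (Q × α × Q) with he | hne
  · exact ⟨0, 0, le_rfl, one_pos, fun w r _ => (he.false (infTrans w r 0)).elim⟩
  let g : Q × α × Q → ℝ := fun t => if t ∈ A.trans then 1 / (A.discount t : ℝ) else 0
  have hd : ∀ t ∈ A.trans, (1 : ℝ) < A.discount t := fun t ht => by
    exact_mod_cast A.one_lt_discount t ht
  have hg0 : ∀ t, 0 ≤ g t := fun t => by
    by_cases h : t ∈ A.trans
    · have := hd t h
      simp only [g, h, if_true]
      positivity
    · simp [g, h]
  have hg1 : ∀ t, g t < 1 := fun t => by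
    by_cases h : t ∈ A.trans
    · have := hd t h
      simp only [g, h, if_true]
      rw [div_lt_one] <;> linarith
    · simp [g, h]
  obtain ⟨t, ht⟩ := Finite.exists_max g
  refine ⟨M, g t, hg0 t, hg1 t, fun w r hr i => ?_⟩
  have hprod : ∏ j ∈ Finset.range i, 1 / (A.discount (infTrans w r j) : ℝ)
      = ∏ j ∈ Finset.range i, g (infTrans w r j) :=
    Finset.prod_congr rfl fun j _ => by simp [g, hr.2 j]
  have h1 : |(A.weight (infTrans w r i) : ℝ)| ≤ M := hM ⟨_, rfl⟩
  have h2 : 0 ≤ ∏ j ∈ Finset.range i, g (infTrans w r j) := Finset.prod_nonneg fun j _ => hg0 _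
  have h3 : ∏ j ∈ Finset.range i, g (infTrans w r j) ≤ g t ^ i := by
    simpa using Finset.prod_le_prod (s := Finset.range i) (fun j _ => hg0 (infTrans w r j))
      (fun j _ => ht (infTrans w r j))
  rw [infRunTerm, hprod, norm_mul, Real.norm_eq_abs, Real.norm_eq_abs, abs_of_nonneg h2]
  exact mul_le_mul h1 h3 h2 ((abs_nonneg _).trans h1)

theorem summable_infRunTerm [Finite α] [Finite Q] (A : NMDA α Q) {w : ℕ → α} {r : ℕ → Q}
    (hr : A.IsInfRun w r) : Summable (A.infRunTerm w r) := by
  obtain ⟨M, b, hb0, hb1, h⟩ := A.exists_bound_infRunTerm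
  exact Summable.of_norm_bounded ((summable_geometric_of_lt_one hb0 hb1).mul_left M) (h w r hr)

theorem bddBelow_infRunValue [Finite α] [Finite Q] (A : NMDA α Q) (w : ℕ → α) :
    BddBelow {v | ∃ r, A.IsInfRun w r ∧ A.infRunValue w r = v} := by
  obtain ⟨M, b, hb0, hb1, h⟩ := A.exists_bound_infRunTerm
  refine ⟨-(∑' i, M * b ^ i), ?_⟩
  rintro v ⟨r, hr, rfl⟩
  have := tsum_of_norm_bounded
    ((summable_geometric_of_lt_one hb0 hb1).mul_left M).hasSum (h w r hr)
  exact (abs_le.mp this).1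

end NMDA

/-!
The lower bound is a fooling-set argument for discounted sums, with an automaton over two letters.

The automaton `countdown l n` has the states `0, …, n - 1`, all of them initial, and counts down
modulo `n` whatever it reads; only reading `true` in the state `0` costs anything, namely `1`. So
its run from `k` pays exactly for the letters `true` at the positions congruent to `k` modulo `n`.
For sets `S, T ⊆ {0, …, n - 1}`, let `u_S` be the word of length `n` with the letter `true` outside
`S`, and `v_T` the word of length `n` with the letter `true` inside `T`. With `x = 1 / l`, the run
from `k` on `u_S v_T` costs `[k ∉ S] x ^ k + [k ∈ T] x ^ (n + k)`. Let `f S T` be the minimum of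
this over `k`. If `S` is nonempty then `f S S = x ^ (n + max S)`, and `f S T ≤ f S S`; if `S ⊈ T`
then `f S T = 0`. Hence `f S T + f T S < f S S + f T T` for distinct nonempty `S` and `T`.

Now let `B` be equivalent to the negation, and choose a (nearly) optimal run of `B` on each
`u_S v_S`. If the runs for `S ≠ T` were in the same state after `n` letters, then exchanging
their second halves would give runs on `u_S v_T` and `u_T v_S` with the same total value, so
`- f S T - f T S ≤ - f S S - f T T`, a contradiction (`card_le_of_fooling`). So `B` has at least
`2 ^ n - 1` states.

Finite and infinite words are treated together. Since automata are complete, finite runs extend to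
infinite ones, so both values are infima, over the infinite runs, of the part of the series that
is indexed by a set `I`: an initial segment of `ℕ`, or all of it (`valueOn`).
-/

namespace NMDA

variable {α Q : Type}

/-! ### Values restricted to a set of positions -/

/-- The infimum, over the infinite runs on `w`, of the sum of the terms at positions in `I`. -/
noncomputable def valueOn (A : NMDA α Q) (I : Set ℕ) (w : ℕ → α) : ℝ :=
  sInf {v | ∃ r, A.IsInfRun w r ∧ ∑' i, I.indicator (A.infRunTerm w r) i = v}

theorem infValue_eq_valueOn (A : NMDA α Q) (w : ℕ → α) :
    A.infValue w = A.valueOn Set.univ w := by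
  simp [infValue, valueOn, infRunValue]

theorem infRunTerm_eq {A : NMDA α Q} {l : ℕ} (hA : A.IsNDA l) {w : ℕ → α} {r : ℕ → Q}
    (hr : A.IsInfRun w r) (i : ℕ) :
    A.infRunTerm w r i = (A.weight (infTrans w r i) : ℝ) * (1 / (l : ℝ)) ^ i := by
  rw [infRunTerm, Finset.prod_congr rfl fun j _ => by rw [hA _ (hr.2 j)]]
  simp

theorem finRunValue_eq {A : NMDA α Q} {l : ℕ} (hA : A.IsNDA l) {u : List α}
    {r : Fin (u.length + 1) → Q} (hr : A.IsFinRun u r) :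
    A.finRunValue u r =
      ∑ i : Fin u.length, (A.weight (finTrans u r i) : ℝ) * (1 / (l : ℝ)) ^ (i : ℕ) := by
  refine Finset.sum_congr rfl fun i _ => ?_
  rw [Finset.prod_congr rfl fun j _ => by rw [hA _ (hr.2 j)]]
  simp

theorem IsFinRun.exists_isInfRun {A : NMDA α Q} {u : List α} {r : Fin (u.length + 1) → Q}
    (hr : A.IsFinRun u r) {w : ℕ → α} (hw : ∀ i : Fin u.length, w i = u.get i) :
    ∃ r', A.IsInfRun w r' ∧ ∀ i : Fin (u.length + 1), r' i = r i := by
  choose f hf using A.complete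
  let g : ℕ → Q := fun n => Nat.rec (r 0)
    (fun k p => if h : k < u.length then r (Fin.succ ⟨k, h⟩) else f p (w k)) n
  have hg : ∀ i : Fin (u.length + 1), g i = r i := by
    intro i
    cases i using Fin.cases with
    | zero => rfl
    | succ i =>
      simp [g]
      rfl
  refine ⟨g, ⟨hr.1, fun i => ?_⟩, hg⟩
  by_cases h : i < u.length
  · have h1 := hg (Fin.castSucc ⟨i, h⟩)
    have h2 := hg (Fin.succ ⟨i, h⟩)
    have h3 := hw ⟨i, h⟩
    have := hr.2 ⟨i, h⟩
    simp only [Fin.val_castSucc, Fin.val_succ] at h1 h2 h3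
    rwa [finTrans, ← h1, ← h2, ← h3] at this
  · have h1 : g (i + 1) = f (g i) (w i) := by simp [g, h]
    rw [infTrans, h1]
    exact hf _ _

theorem finValue_eq_valueOn {A : NMDA α Q} {l : ℕ} (hA : A.IsNDA l) {u : List α} {w : ℕ → α}
    (hw : ∀ i : Fin u.length, w i = u.get i) :
    A.finValue u = A.valueOn (Set.Iio u.length) w := by
  -- A run on `w` restricts to a run on `u` of the same value, and every run on `u` arises so.
  have key : ∀ (r : Fin (u.length + 1) → Q) (r' : ℕ → Q), A.IsFinRun u r → A.IsInfRun w r' →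
      (∀ i : Fin (u.length + 1), r' i = r i) →
      ∑' i, (Set.Iio u.length).indicator (A.infRunTerm w r') i = A.finRunValue u r := by
    intro r r' hr hr' h
    rw [finRunValue_eq hA hr, tsum_eq_sum (s := Finset.range u.length)
      (fun i hi => Set.indicator_of_notMem (by simpa using hi) _), Finset.sum_range]
    refine Finset.sum_congr rfl fun i _ => ?_
    rw [Set.indicator_of_mem (by simp), infRunTerm_eq hA hr', infTrans, finTrans, hw i, ← h, ← h]
    rfl
  unfold finValue valueOn
  congr 1
  ext v
  constructor
  · rintro ⟨r, hr, rfl⟩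
    obtain ⟨r', hr', h⟩ := hr.exists_isInfRun hw
    exact ⟨r', hr', key r r' hr hr' h⟩
  · rintro ⟨r', hr', rfl⟩
    have hr : A.IsFinRun u (fun i => r' i) := by
      refine ⟨hr'.1, fun i => ?_⟩
      have := hr'.2 i
      rwa [infTrans, hw i] at this
    exact ⟨_, hr, (key _ r' hr hr' fun _ => rfl).symm⟩

theorem summable_indicator_infRunTerm [Finite α] [Finite Q] (A : NMDA α Q) (I : Set ℕ)
    {w : ℕ → α} {r : ℕ → Q} (hr : A.IsInfRun w r) :
    Summable (I.indicator (A.infRunTerm w r)) :=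
  (A.summable_infRunTerm hr).indicator I

theorem valueOn_le [Finite α] [Finite Q] (A : NMDA α Q) (I : Set ℕ) {w : ℕ → α} {r : ℕ → Q}
    (hr : A.IsInfRun w r) : A.valueOn I w ≤ ∑' i, I.indicator (A.infRunTerm w r) i := by
  refine csInf_le ?_ ⟨r, hr, rfl⟩
  obtain ⟨M, b, hb0, hb1, h⟩ := A.exists_bound_infRunTerm
  refine ⟨-(∑' i, M * b ^ i), ?_⟩
  rintro v ⟨r, hr, rfl⟩
  have := tsum_of_norm_bounded ((summable_geometric_of_lt_one hb0 hb1).mul_left M).hasSum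
    (fun i => (norm_indicator_le_norm_self (s := I) _ i).trans (h w r hr i))
  exact (abs_le.mp this).1

theorem le_valueOn (A : NMDA α Q) (I : Set ℕ) {w : ℕ → α} {b : ℝ}
    (h : ∀ r, A.IsInfRun w r → b ≤ ∑' i, I.indicator (A.infRunTerm w r) i) :
    b ≤ A.valueOn I w := by
  obtain ⟨r, hr⟩ := A.exists_isInfRun w
  refine le_csInf ⟨_, r, hr, rfl⟩ ?_
  rintro v ⟨r, hr, rfl⟩
  exact h r hr

theorem exists_lt_valueOn_add (A : NMDA α Q) (I : Set ℕ) (w : ℕ → α) {ε : ℝ} (hε : 0 < ε) :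
    ∃ r, A.IsInfRun w r ∧ ∑' i, I.indicator (A.infRunTerm w r) i < A.valueOn I w + ε := by
  obtain ⟨r, hr⟩ := A.exists_isInfRun w
  obtain ⟨v, ⟨r, hr, rfl⟩, hv⟩ := exists_lt_of_csInf_lt
    (s := {v | ∃ r, A.IsInfRun w r ∧ ∑' i, I.indicator (A.infRunTerm w r) i = v})
    ⟨_, r, hr, rfl⟩ (lt_add_of_pos_right (A.valueOn I w) hε)
  exact ⟨r, hr, hv⟩

/-! ### Exchanging the tails of runs -/

/-- The sequence that agrees with `f` before position `n` and with `g` from there on. -/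
def splice {β : Type} (n : ℕ) (f g : ℕ → β) (i : ℕ) : β := if i < n then f i else g i

theorem infTrans_splice {n : ℕ} {w w' : ℕ → α} {r r' : ℕ → Q} (h : r n = r' n) (i : ℕ) :
    infTrans (splice n w w') (splice n r r') i =
      if i < n then infTrans w r i else infTrans w' r' i := by
  unfold infTrans splice
  rcases lt_trichotomy (i + 1) n with hi | rfl | hi
  · simp [hi, Nat.lt_of_succ_lt hi]
  · simp [h]
  · have h1 : ¬ i + 1 < n := by omega
    have h2 : ¬ i < n := by omega
    simp [h1, h2]

theorem IsInfRun.splice {A : NMDA α Q} {n : ℕ} {w w' : ℕ → α} {r r' : ℕ → Q}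
    (hr : A.IsInfRun w r) (hr' : A.IsInfRun w' r') (h : r n = r' n) :
    A.IsInfRun (splice n w w') (splice n r r') := by
  refine ⟨?_, fun i => ?_⟩
  · unfold NMDA.splice
    split_ifs
    exacts [hr.1, hr'.1]
  · rw [infTrans_splice h]
    split_ifs
    exacts [hr.2 i, hr'.2 i]

/-- Exchanging the tails of two runs that meet after `n` letters does not change the sum of their
values. -/
theorem valueOn_splice_add_le [Finite α] [Finite Q] {A : NMDA α Q} {l : ℕ} (hA : A.IsNDA l)
    (I : Set ℕ) {n : ℕ} {w w' : ℕ → α} {r r' : ℕ → Q}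
    (hr : A.IsInfRun w r) (hr' : A.IsInfRun w' r') (h : r n = r' n) :
    A.valueOn I (splice n w w') + A.valueOn I (splice n w' w) ≤
      ∑' i, I.indicator (A.infRunTerm w r) i + ∑' i, I.indicator (A.infRunTerm w' r') i := by
  have h1 := hr.splice hr' h
  have h2 := hr'.splice hr h.symm
  refine (add_le_add (A.valueOn_le I h1) (A.valueOn_le I h2)).trans_eq ?_
  rw [← (A.summable_indicator_infRunTerm I h1).tsum_add (A.summable_indicator_infRunTerm I h2),
    ← (A.summable_indicator_infRunTerm I hr).tsum_add (A.summable_indicator_infRunTerm I hr')]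
  refine tsum_congr fun i => ?_
  by_cases hi : i ∈ I
  · simp only [Set.indicator_of_mem hi]
    rw [infRunTerm_eq hA h1, infRunTerm_eq hA h2, infRunTerm_eq hA hr, infRunTerm_eq hA hr',
      infTrans_splice h, infTrans_splice h.symm]
    split_ifs
    · rfl
    · exact add_comm _ _
  · simp [Set.indicator_of_notMem hi]

/-- A fooling-set bound: if mixing the words `w S` and `w T` at position `n` increases the total
value by at least `2 * ε`, then nearly optimal runs on these words are in different states at
position `n`. -/
theorem card_le_of_fooling [Finite α] [Fintype Q] {B : NMDA α Q} {l : ℕ} (hB : B.IsNDA l)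
    (I : Set ℕ) {K : Type} (s : Finset K) (w : K → ℕ → α) (n : ℕ) {ε : ℝ} (hε : 0 < ε)
    (h : ∀ S ∈ s, ∀ T ∈ s, S ≠ T → B.valueOn I (w S) + B.valueOn I (w T) + 2 * ε ≤
      B.valueOn I (splice n (w S) (w T)) + B.valueOn I (splice n (w T) (w S))) :
    s.card ≤ Fintype.card Q := by
  choose r hr hlt using fun S => B.exists_lt_valueOn_add I (w S) hε
  refine Finset.card_le_card_of_injOn (fun S => r S n) (fun _ _ => Finset.mem_univ _) ?_
  intro S hS T hT hST
  by_contra hne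
  have h1 := h S hS T hT hne
  have h2 := valueOn_splice_add_le hB I (hr S) (hr T) hST
  have h3 := hlt S
  have h4 := hlt T
  linarith

/-! ### The countdown automaton -/

/-- The automaton that counts down modulo `n` from an arbitrary initial state, and pays `1` for
reading `true` in the state `0`. -/
def countdown (l : ℕ) (hl : 2 ≤ l) (n : ℕ) (hn : 1 ≤ n) : NMDA Bool (Fin n) where
  init := Set.univ
  trans := {t | t.1.val ≡ t.2.2.val + 1 [MOD n]}
  weight t := if t.2.1 = true ∧ t.1.val = 0 then 1 else 0
  discount _ := l
  one_lt_discount _ _ := by exact_mod_cast hl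
  init_nonempty := ⟨⟨0, hn⟩, trivial⟩
  complete q _ := by
    refine ⟨⟨(q + (n - 1)) % n, Nat.mod_lt _ hn⟩, ?_⟩
    have h : q.val + (n - 1) + 1 = q.val + n := by omega
    change q.val ≡ (q + (n - 1)) % n + 1 [MOD n]
    exact (((Nat.mod_modEq _ n).add_right 1).trans (by rw [h]; simp [Nat.ModEq])).symm

variable {l n : ℕ} {hl : 2 ≤ l} {hn : 1 ≤ n}

theorem countdown_isNDA : (countdown l hl n hn).IsNDA l := fun _ _ => rfl

theorem countdown_run_eq_zero_iff {w : ℕ → Bool} {r : ℕ → Fin n}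
    (hr : (countdown l hl n hn).IsInfRun w r) (i : ℕ) :
    (r i).val = 0 ↔ i % n = (r 0).val := by
  have h : ∀ i, (r 0).val ≡ (r i).val + i [MOD n] := by
    intro i
    induction i with
    | zero => rfl
    | succ i ih =>
      have h1 : (r i).val ≡ (r (i + 1)).val + 1 [MOD n] := hr.2 i
      refine ih.trans ((h1.add_right i).trans ?_)
      rw [add_assoc, add_comm 1 i]
  have h0 : (r 0).val % n = (r 0).val := Nat.mod_eq_of_lt (r 0).2
  constructor
  · intro hi
    have := h i
    rw [hi, zero_add, Nat.ModEq, h0] at this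
    exact this.symm
  · intro hi
    have h1 : i ≡ (r 0).val [MOD n] := by rw [Nat.ModEq, hi, h0]
    have h2 : 0 + i ≡ (r i).val + i [MOD n] := by simpa using h1.trans (h i)
    have h3 := h2.add_right_cancel' i
    rw [Nat.ModEq, Nat.mod_eq_of_lt (r i).2] at h3
    simpa using h3.symm

theorem exists_countdown_run (w : ℕ → Bool) (k : Fin n) :
    ∃ r, (countdown l hl n hn).IsInfRun w r ∧ r 0 = k := by
  choose f hf using (countdown l hl n hn).complete
  exact ⟨fun i => Nat.rec k (fun j p => f p (w j)) i, ⟨trivial, fun i => hf _ _⟩, rfl⟩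

/-- The word with the letter `true` at the positions `k < n` with `k ∉ S`, and at the positions
`n + k` with `k ∈ S`. -/
def setWord (n : ℕ) (S : Finset ℕ) (i : ℕ) : Bool :=
  if i < n then decide (i ∉ S) else decide (i - n ∈ S)

theorem tsum_countdown_splice {I : Set ℕ} (hI : Set.Iio (2 * n) ⊆ I) {S T : Finset ℕ}
    (hT : T ⊆ Finset.range n) {r : ℕ → Fin n}
    (hr : (countdown l hl n hn).IsInfRun (splice n (setWord n S) (setWord n T)) r) :
    ∑' i, I.indicator ((countdown l hl n hn).infRunTerm
        (splice n (setWord n S) (setWord n T)) r) i =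
      (if (r 0).val ∈ S then 0 else (1 / (l : ℝ)) ^ (r 0).val) +
        (if (r 0).val ∈ T then (1 / (l : ℝ)) ^ (n + (r 0).val) else 0) := by
  have hk := (r 0).2
  set k := (r 0).val with hk0
  have hterm : ∀ i, (countdown l hl n hn).infRunTerm (splice n (setWord n S) (setWord n T)) r i =
      if splice n (setWord n S) (setWord n T) i = true ∧ i % n = k
        then (1 / (l : ℝ)) ^ i else 0 := by
    intro i
    have h0 := countdown_run_eq_zero_iff hr i
    rw [infRunTerm_eq countdown_isNDA hr]
    simp only [countdown, infTrans, h0, ← hk0]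
    split_ifs <;> simp
  have hne : k ≠ n + k := by omega
  rw [tsum_eq_sum (s := {k, n + k}), Finset.sum_pair hne,
    Set.indicator_of_mem (hI (by simp; omega)), Set.indicator_of_mem (hI (by simp; omega)),
    hterm, hterm]
  · simp [splice, setWord, hk, Nat.mod_eq_of_lt hk, ite_not]
  · intro i hi
    by_cases hiI : i ∈ I
    · rw [Set.indicator_of_mem hiI, hterm, if_neg]
      rintro ⟨hw, hm⟩
      simp only [Finset.mem_insert, Finset.mem_singleton, not_or] at hi
      by_cases hin : i < n
      · rw [Nat.mod_eq_of_lt hin] at hm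
        exact hi.1 hm
      · have hiT : i - n ∈ T := by simpa [splice, setWord, hin] using hw
        have hlt := Finset.mem_range.1 (hT hiT)
        rw [Nat.mod_eq_sub_mod (by omega), Nat.mod_eq_of_lt hlt] at hm
        omega
    · exact Set.indicator_of_notMem hiI _

theorem valueOn_countdown_splice_le {I : Set ℕ} (hI : Set.Iio (2 * n) ⊆ I) {S T : Finset ℕ}
    (hT : T ⊆ Finset.range n) {k : ℕ} (hk : k < n) (hkS : k ∈ S) :
    (countdown l hl n hn).valueOn I (splice n (setWord n S) (setWord n T)) ≤
      if k ∈ T then (1 / (l : ℝ)) ^ (n + k) else 0 := by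
  obtain ⟨r, hr, hr0⟩ := exists_countdown_run (l := l) (hl := hl) (hn := hn)
    (splice n (setWord n S) (setWord n T)) ⟨k, hk⟩
  refine (valueOn_le _ I hr).trans_eq ?_
  rw [tsum_countdown_splice hI hT hr, hr0]
  simp [hkS]

theorem le_valueOn_countdown_setWord {I : Set ℕ} (hI : Set.Iio (2 * n) ⊆ I) {S : Finset ℕ}
    (hS : S ⊆ Finset.range n) (hne : S.Nonempty) :
    (1 / (l : ℝ)) ^ (n + S.max' hne) ≤ (countdown l hl n hn).valueOn I (setWord n S) := by
  have hself : splice n (setWord n S) (setWord n S) = setWord n S := by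
    ext i
    simp [splice]
  have hl' : (2 : ℝ) ≤ l := by exact_mod_cast hl
  have hx0 : 0 ≤ 1 / (l : ℝ) := by positivity
  have hx1 : 1 / (l : ℝ) ≤ 1 := by rw [div_le_one] <;> linarith
  refine le_valueOn _ I fun r hr => ?_
  rw [← hself] at hr ⊢
  rw [tsum_countdown_splice hI hS hr]
  split_ifs with h
  · rw [zero_add]
    exact pow_le_pow_of_le_one hx0 hx1 (by have := S.le_max' _ h; omega)
  · rw [add_zero]
    exact pow_le_pow_of_le_one hx0 hx1 (by have := (r 0).2; omega)

theorem countdown_fooling {I : Set ℕ} (hI : Set.Iio (2 * n) ⊆ I) {S T : Finset ℕ}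
    (hS : S ⊆ Finset.range n) (hT : T ⊆ Finset.range n) (hSne : S.Nonempty) (hTne : T.Nonempty)
    (hST : S ≠ T) :
    (countdown l hl n hn).valueOn I (splice n (setWord n S) (setWord n T)) +
        (countdown l hl n hn).valueOn I (splice n (setWord n T) (setWord n S)) +
        (1 / (l : ℝ)) ^ (2 * n) ≤
      (countdown l hl n hn).valueOn I (setWord n S) +
        (countdown l hl n hn).valueOn I (setWord n T) := by
  have hl' : (2 : ℝ) ≤ l := by exact_mod_cast hl
  have hx0 : 0 ≤ 1 / (l : ℝ) := by positivity
  have hx1 : 1 / (l : ℝ) ≤ 1 := by rw [div_le_one] <;> linarith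
  have hpos : ∀ {U : Finset ℕ}, U ⊆ Finset.range n → U.Nonempty →
      (1 / (l : ℝ)) ^ (2 * n) ≤ (countdown l hl n hn).valueOn I (setWord n U) := by
    intro U hU hne
    refine (pow_le_pow_of_le_one hx0 hx1 ?_).trans (le_valueOn_countdown_setWord hI hU hne)
    have := Finset.mem_range.1 (hU (U.max'_mem hne))
    omega
  have hzero : ∀ {U V : Finset ℕ}, U ⊆ Finset.range n → V ⊆ Finset.range n → ¬ U ⊆ V →
      (countdown l hl n hn).valueOn I (splice n (setWord n U) (setWord n V)) ≤ 0 := by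
    intro U V hU hV h
    obtain ⟨k, hkU, hkV⟩ := Finset.not_subset.1 h
    simpa [hkV] using valueOn_countdown_splice_le (l := l) (hl := hl) (hn := hn) hI hV
      (Finset.mem_range.1 (hU hkU)) hkU
  have hle : ∀ {U V : Finset ℕ}, U ⊆ Finset.range n → V ⊆ Finset.range n → U.Nonempty →
      (countdown l hl n hn).valueOn I (splice n (setWord n U) (setWord n V)) ≤
        (countdown l hl n hn).valueOn I (setWord n U) := by
    intro U V hU hV hne
    refine (valueOn_countdown_splice_le hI hV (Finset.mem_range.1 (hU (U.max'_mem hne)))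
      (U.max'_mem hne)).trans (le_trans ?_ (le_valueOn_countdown_setWord hI hU hne))
    split_ifs
    · exact le_rfl
    · positivity
  by_cases h : S ⊆ T
  · have h' : ¬ T ⊆ S := fun h' => hST (h.antisymm h')
    linarith [hle hS hT hSne, hzero hT hS h', hpos hT hTne]
  · linarith [hle hT hS hTne, hzero hS hT h, hpos hS hSne]

/-- The lower bound, for finite words of length `2 * n` (`I = Set.Iio (2 * n)`) and for infinite words
(`I = Set.univ`) alike. -/
theorem two_pow_sub_one_le_card [Fintype Q] {B : NMDA Bool Q} (hB : B.IsNDA l) {I : Set ℕ}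
    (hI : Set.Iio (2 * n) ⊆ I)
    (h : ∀ w, B.valueOn I w = -(countdown l hl n hn).valueOn I w) :
    2 ^ n - 1 ≤ Fintype.card Q := by
  have hl' : (0 : ℝ) < l := by exact_mod_cast (by omega : 0 < l)
  have hcard : ((Finset.range n).powerset.erase ∅).card = 2 ^ n - 1 := by
    rw [Finset.card_erase_of_mem (by simp), Finset.card_powerset, Finset.card_range]
  rw [← hcard]
  refine card_le_of_fooling hB I _ (setWord n) n (ε := (1 / (l : ℝ)) ^ (2 * n) / 2)
    (by positivity) fun S hS T hT hST => ?_
  simp only [Finset.mem_erase, Finset.mem_powerset, ← Finset.nonempty_iff_ne_empty] at hS hT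
  have := countdown_fooling (l := l) (hl := hl) (hn := hn) hI hS.2 hT.2 hS.1 hT.1 hST
  simp only [h]
  linarith

end NMDA

theorem mainTheorem8 :
    ∃ (α : Type) (_ : Fintype α) (c : ℝ), 0 < c ∧
      ∀ l : ℕ, 2 ≤ l → ∀ n : ℕ, 1 ≤ n →
        ∃ A : NMDA α (Fin n), A.IsNDA l ∧
          ∀ (Q : Type) [Fintype Q] (B : NMDA α Q), B.IsNDA l →
            (B.EquivNegFin A ∨ B.EquivNegInf A) →
              c * 2 ^ n ≤ (Fintype.card Q : ℝ) := by
  refine ⟨Bool, inferInstance, 1 / 2, by norm_num, fun l hl n hn =>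
    ⟨NMDA.countdown l hl n hn, NMDA.countdown_isNDA, fun Q _ B hB h => ?_⟩⟩
  have key : 2 ^ n - 1 ≤ Fintype.card Q := by
    rcases h with h | h
    · refine NMDA.two_pow_sub_one_le_card (hl := hl) (hn := hn) hB subset_rfl fun w => ?_
      have hw : ∀ i : Fin (List.ofFn fun i : Fin (2 * n) => w i).length,
          w i = (List.ofFn fun i : Fin (2 * n) => w i).get i := by simp
      have := h (List.ofFn fun i : Fin (2 * n) => w i)
      rwa [NMDA.finValue_eq_valueOn hB hw, NMDA.finValue_eq_valueOn NMDA.countdown_isNDA hw,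
        List.length_ofFn] at this
    · refine NMDA.two_pow_sub_one_le_card (hl := hl) (hn := hn) hB (Set.subset_univ _) fun w => ?_
      rw [← NMDA.infValue_eq_valueOn, ← NMDA.infValue_eq_valueOn]
      exact h w
  have h2 : 2 ≤ 2 ^ n := by simpa using Nat.pow_le_pow_right two_pos hn
  have h3 : (2 : ℝ) ^ n ≤ 2 * Fintype.card Q := by
    exact_mod_cast (by omega : 2 ^ n ≤ 2 * Fintype.card Q)
  linarith
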